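/- Setting. $G=(V,E)$ is a finite simple graph whose nodes are the processors of a synchronous message-passing network. Nodes have unique identifiers; in every round each node may send a (possibly different) bit string to each of its neighbors, receives the messages of its neighbors and performs an arbitrary deterministic local computation; communication is possible in both directions over every edge. The round complexity is the number of rounds until all nodes have terminated with an output. Each edge of $G$ is oriented, and $\beta_v$ denotes the maximum of $1$ and the outdegree of $v$. An oriented list defective coloring instance with color space $\{1,\dots,C\}$, $C\ge 1$, consists of the orientation and, for every node $v$, a list $L_v\subseteq\{1,\dots,C\}$ and a defect function $d_v:L_v\to\mathbb{N}_0$; to solve it, every node $v$ has to output a color $x_v\in L_v$ such that at most $d_v(x_v)$ outneighbors $u$ of $v$ have $x_u=x_v$. Further, $\log=\log_2$, and $\log^* q$ is the least number of times $\log_2$ has to be applied to $q$ to reach a value at most $1$. Theorem. Let $G=(V,E)$ be equipped with a proper $q$-vertex coloring and an edge orientation, and let an oriented list defective coloring instance with lists $L_v\subseteq\{1,\dots,C\}$ and defect functions $d_v$ be given such that $$\forall v\in V:\quad \sum_{x\in L_v}(d_v(x)+1)\ \ge\ 3\sqrt{C}\cdot\beta_v .$$ Then there is a deterministic $O(\log^3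 C+\log^* q)$-round algorithm that solves the instance using messages of $O(\log q+\log C)$ bits. Here the constants hidden in the $O$-notation are absolute, and the algorithm depends only on $q$ and $C$: initially a node knows only $q$, $C$, its identifier, its incident edges and which of them are oriented away from it, its initial color, its list and its defect function. -/

import Mathlib

/-!
Synchronous deterministic message passing on a finite graph, oriented list defective
coloring instances, and the iterated logarithm.
-/

/-- `logStar x` is the least `i` such that the `i`-fold iterate of `log₂` at `x` is at most `1`.
(As long as the value has not dropped to `1`, the next logarithm is taken of a number `> 1`.) -/
noncomputable def logStar (x : ℝ) : ℕ :=
  sInf {i : ℕ | (Real.logb 2)^[i] x ≤ 1}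

/-- The set in the definition of `logStar` is never empty. -/
theorem logStar_set_nonempty (x : ℝ) : {i : ℕ | (Real.logb 2)^[i] x ≤ 1}.Nonempty := by
  have key : ∀ n : ℕ, ∀ y : ℝ, y ≤ n → ∃ i : ℕ, (Real.logb 2)^[i] y ≤ 1 := by
    intro n
    induction n with
    | zero => intro y hy; exact ⟨0, by simp at hy ⊢; linarith⟩
    | succ n ih =>
      intro y hy
      by_cases h1 : y ≤ 1
      · exact ⟨0, by simpa using h1⟩
      push Not at h1
      have hlog : Real.logb 2 y ≤ n := by
        rw [Real.logb_le_iff_le_rpow (by norm_num) (by linarith)]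
        have : ((n + 1 : ℕ) : ℝ) ≤ 2 ^ n := by exact_mod_cast (Nat.lt_two_pow_self (n := n))
        simpa using hy.trans this
      obtain ⟨i, hi⟩ := ih _ hlog
      exact ⟨i + 1, by simpa [Function.iterate_succ_apply] using hi⟩
  obtain ⟨n, hn⟩ := exists_nat_ge x
  exact key n x hn

/-- A communication network on the graph `graph`: nodes carry unique identifiers, and every node
`v` numbers its incident edges (its ports) by `0, …, degree v - 1`, in an arbitrary way;
`port v i` is the neighbor at the other end of port `i` of `v`. -/
structure Network (V : Type*) where
  graph : SimpleGraph V
  ident : V → ℕ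
  ident_injective : Function.Injective ident
  degree : V → ℕ
  port : ∀ v, Fin (degree v) ≃ graph.neighborSet v

namespace Network

variable {V : Type*} (N : Network V)

/-- The neighbor of `v` at port `i`. -/
def nbr (v : V) (i : Fin (N.degree v)) : V := (N.port v i : V)

/-- The port under which the neighbor of `v` at port `i` sees `v`. -/
def backPort (v : V) (i : Fin (N.degree v)) : Fin (N.degree (N.nbr v i)) :=
  (N.port (N.nbr v i)).symm ⟨v, (N.port v i).2.symm⟩

end Network

/-- An edge orientation of `G`: every edge is directed in exactly one of the two ways.
`out v u` says that the edge `{v, u}` is directed from `v` to `u`, i.e. `u` is an outneighbor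
of `v`. -/
structure EdgeOrientation {V : Type*} (G : SimpleGraph V) where
  out : V → V → Prop
  adj_of_out : ∀ u v, out u v → G.Adj u v
  out_of_adj : ∀ u v, G.Adj u v → out u v ∨ out v u
  asymm : ∀ u v, out u v → ¬ out v u

/-- An oriented list defective coloring instance on `G` over the color space `{1, …, C}`:
an edge orientation, color lists `L_v ⊆ {1, …, C}` and defect functions `d_v : L_v → ℕ`. -/
structure OLDCInstance {V : Type*} (G : SimpleGraph V) (C : ℕ) where
  orient : EdgeOrientation G
  list : V → Finset ℕ
  list_subset : ∀ v, list v ⊆ Finset.Icc 1 C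
  defect : ∀ v, list v → ℕ

namespace OLDCInstance

variable {V : Type*} {G : SimpleGraph V} {C : ℕ} (I : OLDCInstance G C)

/-- `β_v`: the maximum of `1` and the outdegree of `v`. -/
noncomputable def beta (v : V) : ℕ := max 1 {u | I.orient.out v u}.ncard

/-- The coloring `x` solves the instance: every node `v` gets a color `x v` of its list, and at
most `d_v (x v)` outneighbors of `v` have the same color as `v`. -/
def IsSolution (x : V → ℕ) : Prop :=
  ∀ v, ∃ h : x v ∈ I.list v, {u | I.orient.out v u ∧ x u = x v}.ncard ≤ I.defect v ⟨x v, h⟩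

end OLDCInstance

/-- What a node with `δ` ports knows at the start: its identifier, which of its ports lead to
outneighbors, its color in the given `q`-coloring, its list and its defect function. -/
structure LocalInput (q δ : ℕ) where
  ident : ℕ
  outPorts : Set (Fin δ)
  color : Fin q
  list : Finset ℕ
  defect : list → ℕ

/-- The local input of the node `v`. -/
def localInput {V : Type*} (N : Network V) {q C : ℕ} (φ : N.graph.Coloring (Fin q))
    (I : OLDCInstance N.graph C) (v : V) : LocalInput q (N.degree v) where
  ident := N.ident v
  outPorts := {i | I.orient.out v (N.nbr v i)}
  color := φ v
  list := I.list v
  defect := I.defect v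

/-- A deterministic distributed algorithm. All nodes run the same program; a node with `δ` ports
has a state in `State δ`. Messages are bit strings (the empty string is silence). In each round a
node sends a possibly different message through each port, receives the messages of its neighbors
and computes its new state; local computation is unrestricted. A node terminates as soon as its
state has an output. -/
structure DistAlgorithm (q : ℕ) where
  State : ℕ → Type
  init : ∀ {δ : ℕ}, LocalInput q δ → State δ
  send : ∀ {δ : ℕ}, State δ → Fin δ → List Bool
  step : ∀ {δ : ℕ}, State δ → (Fin δ → List Bool) → State δ
  output : ∀ {δ : ℕ}, State δ → Option ℕ

namespace DistAlgorithm

variable {q : ℕ} (A : DistAlgorithm q) {V : Type*} (N : Network V)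

/-- The message sent through port `i` by a node in state `s`; terminated nodes are silent. -/
def message {δ : ℕ} (s : A.State δ) (i : Fin δ) : List Bool :=
  match A.output s with
  | some _ => []
  | none => A.send s i

/-- The state of the node `v` after `t` rounds, from local inputs `inp`. In each round, the message
arriving at `v` through port `i` is the one its neighbor there sends towards `v`; a terminated node
keeps its state. -/
def run (inp : ∀ v, LocalInput q (N.degree v)) : ℕ → ∀ v, A.State (N.degree v)
  | 0, v => A.init (inp v)
  | t + 1, v =>
    match A.output (run inp t v) with
    | some _ => run inp t v
    | none => A.step (run inp t v)
        (fun i => A.message (run inp t (N.nbr v i)) (N.backPort v i))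

end DistAlgorithm

/-! Give color `x` the weight `d_v(x) + 1`, and weight `0` outside the list. A solution is a
coloring in which every node has fewer outneighbors of its own color than the weight of that color.

With four colors and a proper coloring of the outgoing edges by `Q` colors, total weight above twice
the outdegree suffices. A sweep through the `Q` classes fixes the high bit of each new color, and a
sweep in the opposite order fixes the low bit. Each outneighbor is decided before the node in
exactly one of the sweeps, and the average over the two values of a bit is good enough in both
(`exists_high_bit`, `exists_low_bit`, `twoSweep_evals`).

A color space of size `4 ^ κ`, with `κ = ⌈log₄ C⌉`, is handled digit by digit in base 4: a digit is
chosen with the sums of the weights in its residue class, suitably scaled, and the recursion keeps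
only the outneighbors with the same digit (`chooseColor_evals`). Each level loses a factor 2, in
total `2 ^ κ ≤ 2√C`. To have `Q = O(κ²)`, each level first reduces the colors in the manner of
Linial, with polynomials over a prime field, and tolerates a `1/(8κ)` fraction of monochromatic
outneighbors. This turns the factor 2 into `2(1 + 1/(4κ))`, whose `κ`-th power is at most `(4/3) 2 ^
κ ≤ (8/3)√C`. The `κ` levels take `O(κ³)` rounds.

Beforehand, `O(log* q)` defective reduction rounds shrink the `q`-coloring to colors of `O(κ)` bits,
at the cost of at most a `1/(32C)` fraction of monochromatic outneighbors (`reduceColors_evals`).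
Subtracting their number from the weight of every color costs at most `β_v/32`, which the gap
between `3` and `8/3` covers. -/

/-! ### Broadcast programs and their execution as distributed algorithms -/

/-- The program of a node with `δ` ports that returns a value of type `Y`: either it returns at
once, or it broadcasts a number, and continues in a way depending on the numbers received. -/
inductive Prog (δ : ℕ) (Y : Type) : Type
  | done : Y → Prog δ Y
  | round : ℕ → ((Fin δ → ℕ) → Prog δ Y) → Prog δ Y

namespace Prog

/-- Sequential composition of programs. -/
def bind {δ : ℕ} {Y Z : Type} : Prog δ Y → (Y → Prog δ Z) → Prog δ Z
  | done y, f => f y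
  | round m k, f => round m fun r => (k r).bind f

/-- Broadcast `m` and return the received numbers. -/
def exchange {δ : ℕ} (m : ℕ) : Prog δ (Fin δ → ℕ) := round m done

/-- If every node `v` of `N` runs `P v`, then all nodes return after exactly `T` rounds, node `v`
returns `y v`, and all numbers that are broadcast are below `M`. -/
def Evals {V : Type*} (N : Network V) (M : ℕ) :
    ∀ (_ : ℕ) {Y : V → Type} (_ : ∀ v, Prog (N.degree v) (Y v)) (_ : ∀ v, Y v), Prop
  | 0, _, P, y => ∀ v, P v = done (y v)
  | T + 1, Y, P, y => ∃ (m : V → ℕ) (k : ∀ v, (Fin (N.degree v) → ℕ) → Prog (N.degree v) (Y v)),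
      (∀ v, m v < M) ∧ (∀ v, P v = round (m v) (k v)) ∧
      Evals N M T (fun v => k v fun i => m (N.nbr v i)) y

variable {V : Type*} {N : Network V} {M : ℕ}

/-- All nodes return from the first program after exactly the same number of rounds, so the
continuations start in lockstep. -/
theorem Evals.bind {Y Z : V → Type} {T T' : ℕ} {P : ∀ v, Prog (N.degree v) (Y v)} {y : ∀ v, Y v}
    {f : ∀ v, Y v → Prog (N.degree v) (Z v)} {z : ∀ v, Z v}
    (hP : Evals N M T P y) (hf : Evals N M T' (fun v => f v (y v)) z) :
    Evals N M (T + T') (fun v => (P v).bind (f v)) z := by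
  induction T generalizing P with
  | zero =>
    have : (fun v => (P v).bind (f v)) = fun v => f v (y v) := by
      funext v
      rw [hP v]
      rfl
    rw [this, Nat.zero_add]
    exact hf
  | succ T ih =>
    obtain ⟨m, k, hm, hk, h⟩ := hP
    rw [Nat.add_right_comm]
    refine ⟨m, fun v r => (k v r).bind (f v), hm, fun v => ?_, ih h⟩
    change (P v).bind (f v) = _
    rw [hk v]
    rfl

theorem Evals.map {Y Z : V → Type} {T : ℕ} {P : ∀ v, Prog (N.degree v) (Y v)} {y : ∀ v, Y v}
    (hP : Evals N M T P y) (f : ∀ v, Y v → Z v) :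
    Evals N M T (fun v => (P v).bind fun a => Prog.done (f v a)) (fun v => f v (y v)) :=
  Evals.bind (T' := 0) hP fun _ => rfl

theorem Evals.exchange {m : V → ℕ} (hm : ∀ v, m v < M) :
    Evals N M 1 (fun v => Prog.exchange (m v)) (fun v i => m (N.nbr v i)) :=
  ⟨m, fun _ => Prog.done, hm, fun _ => rfl, fun _ => rfl⟩

/-- The number with the given binary digits, least significant first. -/
def ofBits : List Bool → ℕ
  | [] => 0
  | b :: l => Nat.bit b (ofBits l)

theorem ofBits_bits (n : ℕ) : ofBits n.bits = n := by
  induction n using Nat.binaryRec' with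
  | zero => simp [ofBits]
  | bit b n h ih => rw [Nat.bits_append_bit n b h, ofBits, ih]

/-- The distributed algorithm in which a node runs a program depending on its local input. -/
def algorithm {q : ℕ} (prog : ∀ {δ : ℕ}, LocalInput q δ → Prog δ ℕ) : DistAlgorithm q where
  State δ := Prog δ ℕ
  init := prog
  send s _ := match s with
    | done _ => []
    | round m _ => m.bits
  step s r := match s with
    | done y => done y
    | round _ k => k fun i => ofBits (r i)
  output s := match s with
    | done y => some y
    | round _ _ => none

/-- Numbers below `2 ^ L` have at most `L` binary digits. After the last round every node holds
`done` and stays silent, so the length bound holds at all later times too. -/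
theorem algorithm_run_of_evals {q L : ℕ} (prog : ∀ {δ : ℕ}, LocalInput q δ → Prog δ ℕ)
    (inp : ∀ v, LocalInput q (N.degree v)) {T : ℕ} {P : ∀ v, Prog (N.degree v) ℕ} {x : V → ℕ}
    (h : Evals N (2 ^ L) T P x) {t : ℕ} (ht : ∀ v, (algorithm prog).run N inp t v = P v) :
    (∀ v, (algorithm prog).output ((algorithm prog).run N inp (t + T) v) = some (x v)) ∧
    ∀ t' ≥ t, ∀ v i,
      ((algorithm prog).message ((algorithm prog).run N inp t' v) i).length ≤ L := by
  induction T generalizing t P with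
  | zero =>
    have key : ∀ t' ≥ t, ∀ v, (algorithm prog).run N inp t' v = done (x v) := by
      intro t' ht'
      induction t', ht' using Nat.le_induction with
      | base => intro v; rw [ht v, h v]
      | succ t' _ ih =>
        intro v
        have : (algorithm prog).run N inp (t' + 1) v = (algorithm prog).run N inp t' v := by
          rw [DistAlgorithm.run]
          simp only [ih]
          rfl
        rw [this, ih v]
    refine ⟨fun v => ?_, fun t' ht' v i => ?_⟩
    · rw [key _ (by omega)]
      rfl
    · rw [key _ ht']
      exact Nat.zero_le _
  | succ T ih =>
    obtain ⟨m, k, hm, hk, h⟩ := h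
    have hrun : ∀ v, (algorithm prog).run N inp t v = round (m v) (k v) := fun v => by
      rw [ht v, hk v]
    have hnext : ∀ v, (algorithm prog).run N inp (t + 1) v = k v fun i => m (N.nbr v i) := by
      intro v
      rw [DistAlgorithm.run]
      simp only [hrun]
      change k v (fun i => ofBits (m (N.nbr v i)).bits) = _
      simp only [ofBits_bits]
    obtain ⟨h1, h2⟩ := ih h hnext
    refine ⟨fun v => ?_, fun t' ht' v i => ?_⟩
    · rw [show t + (T + 1) = t + 1 + T by omega]
      exact h1 v
    · rcases ht'.eq_or_lt with rfl | hlt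
      · rw [hrun]
        change (m v).bits.length ≤ L
        rw [Nat.size_eq_bits_len]
        exact Nat.size_le.2 (hm v)
      · exact h2 t' hlt v i

end Prog

/-! ### Defective color reduction by polynomial codes -/

section ColorReduction

open Finset

/-- The polynomials of degree less than `n` over a field with `p` elements give `p ^ n` words of
length `p` over an alphabet of size `p`, any two of which agree in at most `n` places. -/
theorem exists_code {p : ℕ} (hp : p.Prime) (n : ℕ) :
    ∃ E : ℕ → ℕ → ℕ, (∀ c a, E c a < p) ∧ ∀ c c', c < p ^ n → c' < p ^ n → c ≠ c' →
      #{a ∈ range p | E c a = E c' a} ≤ n := by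
  have : Fact p.Prime := ⟨hp⟩
  let e : Fin (p ^ n) ≃ (Fin n → ZMod p) := Fintype.equivOfCardEq (by simp [ZMod.card])
  let poly : Fin (p ^ n) → Polynomial (ZMod p) := fun c =>
    ((Polynomial.degreeLTEquiv (ZMod p) n).symm (e c) : Polynomial.degreeLT (ZMod p) n)
  have hpoly : Function.Injective poly := fun c c' h =>
    e.injective ((Polynomial.degreeLTEquiv (ZMod p) n).symm.injective (Subtype.ext h))
  have hdeg : ∀ c, poly c ∈ Polynomial.degreeLT (ZMod p) n := fun c => Subtype.prop _
  refine ⟨fun c a => if h : c < p ^ n then ((poly ⟨c, h⟩).eval (a : ZMod p)).val else 0,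
    fun c a => ?_, fun c c' hc hc' hne => ?_⟩
  · dsimp only
    split_ifs
    exacts [ZMod.val_lt _, hp.pos]
  · simp only [hc, hc', dite_true]
    set D := poly ⟨c, hc⟩ - poly ⟨c', hc'⟩ with hD
    have hD0 : D ≠ 0 := by
      rw [hD, sub_ne_zero]
      exact fun h => hne (by simpa using hpoly h)
    have hDdeg : D.natDegree ≤ n := by
      have := Polynomial.mem_degreeLT.1 (Submodule.sub_mem _ (hdeg ⟨c, hc⟩) (hdeg ⟨c', hc'⟩))
      exact Polynomial.natDegree_le_of_degree_le this.le
    calc _ ≤ #D.roots.toFinset := by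
          refine card_le_card_of_injOn (fun a : ℕ => (a : ZMod p)) (fun a ha => ?_) ?_
          · have h := (mem_filter.1 ha).2
            simp only [Multiset.mem_toFinset, mem_coe]
            rw [Polynomial.mem_roots hD0, Polynomial.IsRoot, hD, Polynomial.eval_sub,
              ZMod.val_injective p h, sub_self]
          · intro a ha b hb hab
            have ha' := mem_range.1 (mem_filter.1 ha).1
            have hb' := mem_range.1 (mem_filter.1 hb).1
            have := (ZMod.natCast_eq_natCast_iff' a b p).1 hab
            rwa [Nat.mod_eq_of_lt ha', Nat.mod_eq_of_lt hb'] at this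
      _ ≤ D.roots.card := Multiset.toFinset_card_le _
      _ ≤ D.natDegree := Polynomial.card_roots' D
      _ ≤ n := hDdeg

/-- A node with color `c` and active ports `O` that receives the colors `r` can choose a position
`a` of its code word and take the pair of `a` and the `a`-th letter as its new color. -/
theorem exists_linial_color {p : ℕ} (hp : p.Prime) (n : ℕ) {E : ℕ → ℕ → ℕ}
    (hE : ∀ c c', c < p ^ n → c' < p ^ n → c ≠ c' → #{a ∈ range p | E c a = E c' a} ≤ n)
    {δ : ℕ} (O : Finset (Fin δ)) {c : ℕ} {r : Fin δ → ℕ} (hc : c < p ^ n) (hr : ∀ i, r i < p ^ n) :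
    ∃ a < p, p * #{i ∈ O | r i ≠ c ∧ E (r i) a = E c a} ≤ n * #O := by
  -- Averaging over the positions `a`: each active neighbor of a different color collides in at most
  -- `n` of the `p` positions.
  have hsum : ∑ a ∈ range p, p * #{i ∈ O | r i ≠ c ∧ E (r i) a = E c a} ≤
      ∑ _a ∈ range p, n * #O := by
    rw [← mul_sum, sum_const, card_range, smul_eq_mul]
    refine Nat.mul_le_mul_left _ ?_
    calc _ = ∑ a ∈ range p, ∑ i ∈ O, if r i ≠ c ∧ E (r i) a = E c a then 1 else 0 := by
          simp only [card_filter]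
      _ = ∑ i ∈ O, ∑ a ∈ range p, if r i ≠ c ∧ E (r i) a = E c a then 1 else 0 := sum_comm
      _ ≤ ∑ i ∈ O, n := by
          refine sum_le_sum fun i _ => ?_
          rw [← card_filter]
          by_cases h : r i = c
          · simp [h]
          · simpa [h] using hE _ _ (hr i) hc h
      _ = n * #O := by rw [sum_const, smul_eq_mul, mul_comm]
  obtain ⟨a, ha, h⟩ := exists_le_of_sum_le ⟨0, mem_range.2 hp.pos⟩ hsum
  exact ⟨a, mem_range.1 ha, h⟩

open Classical in
/-- One round of color reduction from `p ^ n` to `p ^ 2` colors. -/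
noncomputable def linialStep (p n : ℕ) {δ : ℕ} (c : ℕ) (O : Finset (Fin δ)) : Prog δ ℕ :=
  (Prog.exchange c).bind fun r => .done <|
    if hp : p.Prime then
      if h : ∃ a < p, p * #{i ∈ O | r i ≠ c ∧
        (exists_code hp n).choose (r i) a = (exists_code hp n).choose c a} ≤ n * #O then
        h.choose * p + (exists_code hp n).choose c h.choose
      else 0
    else 0

variable {V : Type*} {N : Network V} {M : ℕ}

/-- The number of active ports of `v` that lead to nodes of the same color as `v`. -/
def mono (N : Network V) (O : ∀ v, Finset (Fin (N.degree v))) (c : V → ℕ) (v : V) : ℕ :=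
  #{i ∈ O v | c (N.nbr v i) = c v}

/-- Outneighbors that already share the color may stay monochromatic; the others add at most an `n /
p` fraction, by the choice of the position. -/
theorem linialStep_evals {p : ℕ} (hp : p.Prime) (n : ℕ) (O : ∀ v, Finset (Fin (N.degree v)))
    {c : V → ℕ} (hc : ∀ v, c v < p ^ n) (hM : ∀ v, c v < M) :
    ∃ c' : V → ℕ, Prog.Evals N M 1 (fun v => linialStep p n (c v) (O v)) c' ∧
      ∀ v, c' v < p ^ 2 ∧ (mono N O c' v : ℝ) ≤ mono N O c v + n / p * #(O v) := by
  classical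
  set E := (exists_code hp n).choose with hEdef
  obtain ⟨hlt, hE⟩ := (exists_code hp n).choose_spec
  have hex := fun v => exists_linial_color hp n hE (O v) (hc v) fun i => hc (N.nbr v i)
  refine ⟨fun v => (hex v).choose * p + E (c v) (hex v).choose, ?_, fun v => ⟨?_, ?_⟩⟩
  · have h := (Prog.Evals.exchange hM).map (Z := fun _ => ℕ) fun v r =>
      if h : ∃ a < p, p * #{i ∈ O v | r i ≠ c v ∧ E (r i) a = E (c v) a} ≤ n * #(O v) then
        h.choose * p + E (c v) h.choose
      else 0
    convert h using 1
    · funext v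
      simp only [linialStep, hp, dite_true, ← hEdef]
    · funext v
      rw [dif_pos (hex v)]
  · have h1 := (hex v).choose_spec.1
    have h2 := hlt (c v) (hex v).choose
    calc _ < (hex v).choose * p + p := by simpa [hEdef] using h2
      _ = ((hex v).choose + 1) * p := by ring
      _ ≤ p * p := Nat.mul_le_mul_right _ h1
      _ = p ^ 2 := by ring
  · obtain ⟨h1, h2⟩ := (hex v).choose_spec
    set a := (hex v).choose with ha
    -- Position and letter are the quotient and the remainder of the new color modulo `p`, so a new
    -- collision forces equal positions and agreement of the two code words there.
    have hcard : mono N O (fun v => (hex v).choose * p + E (c v) (hex v).choose) v ≤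
        mono N O c v + #{i ∈ O v | c (N.nbr v i) ≠ c v ∧ E (c (N.nbr v i)) a = E (c v) a} := by
      unfold mono
      refine (card_le_card fun i hi => ?_).trans (card_union_le _ _)
      obtain ⟨hiO, hi⟩ := mem_filter.1 hi
      rw [mem_union, mem_filter, mem_filter]
      by_cases hcc : c (N.nbr v i) = c v
      · exact Or.inl ⟨hiO, hcc⟩
      · refine Or.inr ⟨hiO, hcc, ?_⟩
        have hmod := congrArg (· % p) hi
        have hdiv := congrArg (· / p) hi
        simp only [Nat.mul_add_mod_self_right, Nat.mod_eq_of_lt (hlt _ _), hEdef] at hmod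
        simp only [Nat.add_div_of_dvd_right (dvd_mul_left p _), Nat.mul_div_cancel _ hp.pos,
          Nat.div_eq_of_lt (hlt _ _), hEdef, add_zero] at hdiv
        rw [hdiv] at hmod
        exact hmod
    have hp0 : (0 : ℝ) < p := by exact_mod_cast hp.pos
    have h2' : (p : ℝ) * #{i ∈ O v | c (N.nbr v i) ≠ c v ∧ E (c (N.nbr v i)) a = E (c v) a} ≤
        n * #(O v) := by exact_mod_cast h2
    have hcard' : (mono N O (fun v => (hex v).choose * p + E (c v) (hex v).choose) v : ℝ) ≤
        mono N O c v +
          #{i ∈ O v | c (N.nbr v i) ≠ c v ∧ E (c (N.nbr v i)) a = E (c v) a} := by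
      exact_mod_cast hcard
    refine hcard'.trans (add_le_add_right ?_ _)
    rw [div_mul_eq_mul_div, le_div_iff₀ hp0]
    linarith

/-- The least prime above `x`. -/
noncomputable def primeAbove (x : ℕ) : ℕ := Nat.find (Nat.exists_infinite_primes (x + 1))

theorem primeAbove_prime (x : ℕ) : (primeAbove x).Prime :=
  (Nat.find_spec (Nat.exists_infinite_primes (x + 1))).2

theorem lt_primeAbove (x : ℕ) : x < primeAbove x :=
  (Nat.find_spec (Nat.exists_infinite_primes (x + 1))).1

theorem primeAbove_le {x : ℕ} (hx : x ≠ 0) : primeAbove x ≤ 2 * x := by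
  obtain ⟨p, hp, h1, h2⟩ := Nat.exists_prime_lt_and_le_two_mul x hx
  exact (Nat.find_min' _ ⟨h1, hp⟩).trans h2

/-- The length of the colors after a round of color reduction, if it was `b` before. -/
def nextBits (r b : ℕ) : ℕ := 2 + 2 * r + 4 * Nat.clog 2 b

/-- The length to which the colors are reduced. -/
def finalBits (r : ℕ) : ℕ := 8 * r + 1000

/-- `t` rounds of color reduction, starting with `b`-bit colors. -/
noncomputable def reduceColors (r : ℕ) {δ : ℕ} (O : Finset (Fin δ)) : ℕ → ℕ → ℕ → Prog δ ℕ
  | 0, _, c => .done c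
  | t + 1, b, c => (linialStep (primeAbove (2 ^ r * b ^ 2)) b c O).bind fun c' =>
      reduceColors r O t (nextBits r b) c'

theorem thirtytwo_mul_clog_le (b : ℕ) : 32 * Nat.clog 2 b ≤ b + 1000 := by
  have key : ∀ l : ℕ, 32 * (l + 1) ≤ 2 ^ l + 1000 := by
    intro l
    rcases le_or_gt l 10 with h | h
    · exact le_add_left (by omega)
    · induction l, h.le using Nat.le_induction with
      | base => norm_num
      | succ l hl ih =>
        rcases hl.eq_or_lt with rfl | hl'
        · norm_num
        · have := ih hl'
          have h2 : 2 ^ 10 ≤ 2 ^ l := Nat.pow_le_pow_right (by norm_num) hl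
          rw [pow_succ]
          omega
  rcases le_or_gt b 1 with h | h
  · rw [Nat.clog_of_right_le_one h]
    omega
  · have h1 := Nat.pow_pred_clog_lt_self (by norm_num : 1 < 2) h
    have h2 := key (Nat.clog 2 b).pred
    have h3 : 0 < Nat.clog 2 b := Nat.clog_pos (by norm_num) h
    rw [Nat.pred_eq_sub_one] at h1 h2
    omega

/-- Since `32 log b ≤ b + 1000`, the left side is at most `b / 4 + 4r + 254`, and `3b / 4` exceeds
`6r + 750` above the final length. This halving makes the defects of successive rounds summable. -/
theorem two_mul_nextBits_le {r b : ℕ} (h : finalBits r < b) : 2 * nextBits r b ≤ b := by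
  have := thirtytwo_mul_clog_le b
  unfold finalBits at h
  unfold nextBits
  omega

/-- Two rounds act like one logarithm: the first brings the length to `O(r + log b)`, the second to
`O(r + log log b)`. The `+ 1` later absorbs the rounding in `Nat.clog`. -/
theorem nextBits_nextBits_le (r b : ℕ) :
    nextBits r b ≤ finalBits r ∨ nextBits r (nextBits r b) ≤ finalBits r ∨
      nextBits r (nextBits r b) + 1 ≤ Nat.clog 2 b := by
  set l := Nat.clog 2 b with hl
  rcases le_or_gt l r with h | h
  · left
    unfold nextBits finalBits
    omega
  · right
    have h1 : nextBits r b ≤ 8 * l := by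
      unfold nextBits
      omega
    have h2 : Nat.clog 2 (nextBits r b) ≤ 3 + Nat.clog 2 l := by
      rw [Nat.clog_le_iff_le_pow (by norm_num), pow_add]
      have := Nat.le_pow_clog (b := 2) (by norm_num) l
      omega
    have h3 := thirtytwo_mul_clog_le l
    have h4 : nextBits r (nextBits r b) = 2 + 2 * r + 4 * Nat.clog 2 (nextBits r b) := rfl
    unfold finalBits
    omega

/-- With a prime above `2 ^ r * b ^ 2`, a round on `b`-bit colors adds a fraction `b / p ≤ (1 / b) /
2 ^ r` of defects. The lengths at least halve each time, so `1 / b + (1 - 1 / b') ≤ 1 - 1 / b` for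
the next length `b'`, and the bound telescopes. -/
theorem reduceColors_evals {r : ℕ} (O : ∀ v, Finset (Fin (N.degree v))) {t b : ℕ} {c : V → ℕ}
    (hb : 1 ≤ b) (ht : ∀ s < t, finalBits r < (nextBits r)^[s] b) (hc : ∀ v, c v < 2 ^ b)
    (hM : 2 ^ b ≤ M) :
    ∃ c' : V → ℕ, Prog.Evals N M t (fun v => reduceColors r (O v) t b (c v)) c' ∧
      ∀ v, c' v < 2 ^ (nextBits r)^[t] b ∧
        (mono N O c' v : ℝ) ≤ mono N O c v + (1 - 1 / b) / 2 ^ r * #(O v) := by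
  induction t generalizing b c with
  | zero =>
    refine ⟨c, fun v => rfl, fun v => ⟨hc v, ?_⟩⟩
    have : (1 : ℝ) / b ≤ 1 := by
      rw [div_le_one (by exact_mod_cast hb)]
      exact_mod_cast hb
    have : 0 ≤ (1 - 1 / (b : ℝ)) / 2 ^ r * #(O v) := by
      have : 0 ≤ 1 - 1 / (b : ℝ) := by linarith
      positivity
    linarith
  | succ t ih =>
    have hb' := two_mul_nextBits_le (ht 0 (by omega))
    rw [Function.iterate_zero, id] at hb'
    set p := primeAbove (2 ^ r * b ^ 2) with hp
    have hprime : p.Prime := primeAbove_prime _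
    have hpow : 2 ^ b ≤ p ^ b := Nat.pow_le_pow_left hprime.two_le b
    have hplt : 2 ^ r * b ^ 2 < p := lt_primeAbove _
    obtain ⟨c₁, h1, h2⟩ := linialStep_evals hprime b O (fun v => (hc v).trans_le hpow)
      (fun v => (hc v).trans_le hM)
    have hp2 : p ^ 2 ≤ 2 ^ nextBits r b := by
      calc p ^ 2 ≤ (2 * (2 ^ r * b ^ 2)) ^ 2 :=
            Nat.pow_le_pow_left (primeAbove_le (by positivity)) 2
        _ = 2 ^ (2 + 2 * r) * b ^ 4 := by ring
        _ ≤ 2 ^ (2 + 2 * r) * (2 ^ Nat.clog 2 b) ^ 4 := by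
            gcongr
            exact Nat.le_pow_clog (by norm_num) b
        _ = 2 ^ nextBits r b := by
            unfold nextBits
            ring
    have hb1 : 1 ≤ nextBits r b := by
      unfold nextBits
      omega
    obtain ⟨c', h3, h4⟩ := ih (c := c₁) hb1
      (fun s hs => by simpa [Function.iterate_succ_apply] using ht (s + 1) (by omega))
      (fun v => (h2 v).1.trans_le hp2)
      ((Nat.pow_le_pow_right (by norm_num) (by omega)).trans hM)
    refine ⟨c', ?_, fun v => ⟨by simpa [Function.iterate_succ_apply] using (h4 v).1, ?_⟩⟩
    · have h := h1.bind h3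
      rw [Nat.add_comm 1 t] at h
      exact h
    · refine (h4 v).2.trans ?_
      have hb0 : (0 : ℝ) < b := by exact_mod_cast hb
      have hb10 : (0 : ℝ) < nextBits r b := by exact_mod_cast hb1
      have hR : (0 : ℝ) < 2 ^ r := by positivity
      have e1 : (b : ℝ) / p ≤ 1 / b / 2 ^ r := by
        rw [div_div, div_le_div_iff₀ (by exact_mod_cast hprime.pos) (by positivity)]
        have : ((2 ^ r * b ^ 2 : ℕ) : ℝ) ≤ p := by exact_mod_cast hplt.le
        push_cast at this
        linarith
      have e2 : 2 / (b : ℝ) ≤ 1 / nextBits r b := by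
        rw [div_le_div_iff₀ hb0 hb10]
        have : ((2 * nextBits r b : ℕ) : ℝ) ≤ b := by exact_mod_cast hb'
        push_cast at this
        linarith
      have e3 : (b : ℝ) / p + (1 - 1 / nextBits r b) / 2 ^ r ≤ (1 - 1 / b) / 2 ^ r := by
        calc _ ≤ 1 / (b : ℝ) / 2 ^ r + (1 - 2 / b) / 2 ^ r := by gcongr
          _ = (1 - 1 / b) / 2 ^ r := by ring
      have e4 := mul_le_mul_of_nonneg_right e3 (Nat.cast_nonneg (α := ℝ) #(O v))
      have := (h2 v).2
      rw [add_mul] at e4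
      linarith

/-- `logStar`-many pairs of rounds suffice to reduce the colors to the final length. -/
theorem exists_iterate_nextBits_le (r : ℕ) {n : ℕ} {x : ℝ} (hn : (Real.logb 2)^[n] x ≤ 1) {b : ℕ}
    (hb : (b : ℝ) ≤ x) :
    ∃ t ≤ 2 * n, (nextBits r)^[t] b ≤ finalBits r := by
  induction n generalizing x b with
  | zero =>
    have : (b : ℝ) ≤ 1 := hb.trans hn
    have : b ≤ 1 := by exact_mod_cast this
    exact ⟨0, le_rfl, by unfold finalBits; simp; omega⟩
  | succ n ih =>
    rcases le_or_gt b 1 with h1 | h1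
    · exact ⟨0, by omega, by unfold finalBits; simp; omega⟩
    rcases nextBits_nextBits_le r b with h | h | h
    · exact ⟨1, by omega, h⟩
    · exact ⟨2, by omega, h⟩
    · have hlog : ((nextBits r (nextBits r b) : ℕ) : ℝ) ≤ Real.logb 2 x := by
        have hpow : 2 ^ nextBits r (nextBits r b) ≤ b :=
          (Nat.pow_lt_of_lt_clog (by omega)).le
        have hx : (0 : ℝ) < x := lt_of_lt_of_le (by positivity) hb
        rw [Real.le_logb_iff_rpow_le (by norm_num) hx, Real.rpow_natCast]
        exact le_trans (by exact_mod_cast hpow) hb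
      obtain ⟨t, ht, hle⟩ := ih (by simpa [Function.iterate_succ_apply] using hn) hlog
      exact ⟨t + 2, by omega, hle⟩

/-- The number of rounds in which `q` colors are reduced to the final length. -/
theorem exists_reduction_time (r q : ℕ) :
    ∃ t ≤ 2 * logStar q, (nextBits r)^[t] (Nat.clog 2 q + 1) ≤ finalBits r ∧
      ∀ s < t, finalBits r < (nextBits r)^[s] (Nat.clog 2 q + 1) := by
  have key : ∃ t ≤ 2 * logStar q, (nextBits r)^[t] (Nat.clog 2 q + 1) ≤ finalBits r := by
    -- The iteration lemma is applied with `x = q`, which requires the initial length to be at most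
    -- `q`. This fails only for `q ≤ 3`, where the length is already final.
    rcases le_or_gt (Nat.clog 2 q + 1) q with h | h
    · exact exists_iterate_nextBits_le r (Nat.sInf_mem (logStar_set_nonempty q))
        (by exact_mod_cast h)
    · refine ⟨0, by omega, ?_⟩
      have : q ≤ 3 := by
        by_contra! hq
        have h4 : Nat.clog 2 q ≤ q - 1 := by
          rw [Nat.clog_le_iff_le_pow (by norm_num)]
          have := Nat.lt_two_pow_self (n := q - 1)
          omega
        omega
      have := Nat.clog_mono_right 2 this
      have : Nat.clog 2 3 ≤ 2 := by rw [Nat.clog_le_iff_le_pow] <;> norm_num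
      unfold finalBits
      simp
      omega
  classical
  have hex : ∃ t, (nextBits r)^[t] (Nat.clog 2 q + 1) ≤ finalBits r := key.imp fun _ h => h.2
  obtain ⟨t, ht, hle⟩ := key
  exact ⟨Nat.find hex, (Nat.find_min' hex hle).trans ht, Nat.find_spec hex,
    fun s hs => not_le.1 (Nat.find_min hex hs)⟩

end ColorReduction

/-! ### Choosing one of four colors by two opposite sweeps -/

section Sweep

open Finset

/-- `n` further rounds of a sweep over the colors, starting at color `j`: nodes of color `j` replace
their value `cur` by `F r` where `r` are the values received last. -/
def sweepFrom {δ : ℕ} (F : (Fin δ → ℕ) → ℕ) (c : ℕ) :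
    ℕ → ℕ → ℕ → (Fin δ → ℕ) → Prog δ (ℕ × (Fin δ → ℕ))
  | 0, _, cur, r => .done (cur, r)
  | n + 1, j, cur, r => .round (if c = j then F r else cur) fun r' =>
      sweepFrom F c n (j + 1) (if c = j then F r else cur) r'

/-- In a sweep over `Q` colors, each node chooses its value depending on the values of its neighbors
of smaller colors; the values of the other neighbors read `0`. -/
def sweep {δ : ℕ} (F : (Fin δ → ℕ) → ℕ) (c Q : ℕ) : Prog δ (ℕ × (Fin δ → ℕ)) :=
  sweepFrom F c Q 0 0 fun _ => 0

variable {V : Type*} {N : Network V} {M : ℕ}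

theorem sweep_evals {Q : ℕ} {c : V → ℕ} (hc : ∀ v, c v < Q)
    {F : ∀ v, (Fin (N.degree v) → ℕ) → ℕ} (hF : ∀ v r, F v r < M) :
    ∃ val : V → ℕ,
      Prog.Evals N M Q (fun v => sweep (F v) (c v) Q) (fun v => (val v, fun i => val (N.nbr v i))) ∧
      ∀ v, val v = F v fun i => if c (N.nbr v i) < c v then val (N.nbr v i) else 0 := by
  obtain ⟨val, hval⟩ : ∃ val : V → ℕ,
      ∀ v, val v = F v fun i => if c (N.nbr v i) < c v then val (N.nbr v i) else 0 := by
    -- The outcome is defined by well-founded recursion along the colors `c`, independently of the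
    -- rounds.
    refine ⟨(InvImage.wf c Nat.lt_wfRel.wf).fix fun v f =>
      F v fun i => if h : c (N.nbr v i) < c v then f (N.nbr v i) h else 0, fun v => ?_⟩
    rw [WellFounded.fix_eq]
    rfl
  refine ⟨val, ?_, hval⟩
  have hstep : ∀ j v, (if c v = j then F v (fun i => if c (N.nbr v i) < j then val (N.nbr v i) else 0)
      else if c v < j then val v else 0) = if c v < j + 1 then val v else 0 := by
    intro j v
    rcases lt_trichotomy (c v) j with h | h | h
    · rw [if_neg h.ne, if_pos h, if_pos (by omega)]
    · subst h
      rw [if_pos rfl, if_pos (by omega), ← hval]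
    · rw [if_neg h.ne', if_neg (by omega), if_neg (by omega)]
  have key : ∀ n j, j + n = Q → Prog.Evals N M n
      (fun v => sweepFrom (F v) (c v) n j (if c v < j then val v else 0)
        fun i => if c (N.nbr v i) < j then val (N.nbr v i) else 0)
      (fun v => (val v, fun i => val (N.nbr v i))) := by
    intro n
    induction n with
    | zero =>
      intro j hj v
      simp [sweepFrom, show j = Q by omega, hc]
    | succ n ih =>
      intro j hj
      refine ⟨fun v => if c v < j + 1 then val v else 0, fun v r' =>
        sweepFrom (F v) (c v) n (j + 1) (if c v < j + 1 then val v else 0) r', fun v => ?_,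
        fun v => ?_, ih (j + 1) (by omega)⟩
      · have h := hF v
        dsimp only
        split_ifs
        · rw [hval]
          exact h _
        · exact (Nat.zero_le _).trans_lt (h fun _ => 0)
      · simp only [sweepFrom, hstep]
  simpa [sweep] using key Q 0 (by omega)

/-- The sum of the inequalities for `h = 0` and `h = 1` holds, because every decided neighbor has at
most one of the two high bits. -/
theorem exists_high_bit {δ : ℕ} (O : Finset (Fin δ)) (W : ℕ → ℕ) {r : Fin δ → ℕ} :
    ∃ h < 2, ∑ y ∈ range 4, W y + 4 * #{i ∈ O | r i = h + 1} ≤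
      2 * (W (2 * h) + W (2 * h + 1)) + 2 * #{i ∈ O | r i ≠ 0} := by
  have h1 : #{i ∈ O | r i = 0 + 1} + #{i ∈ O | r i = 1 + 1} ≤ #{i ∈ O | r i ≠ 0} := by
    rw [← card_union_of_disjoint]
    · refine card_le_card fun i hi => ?_
      simp only [mem_union, mem_filter] at hi ⊢
      rcases hi with hi | hi <;> exact ⟨hi.1, by omega⟩
    · exact disjoint_filter.2 fun i _ h1 h2 => by omega
  have h2 : ∑ y ∈ range 4, W y = W 0 + W 1 + W 2 + W 3 := by simp [sum_range_succ]
  by_contra! hcon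
  have ha := hcon 0 (by norm_num)
  have hb := hcon 1 (by norm_num)
  norm_num at ha hb h1
  omega

/-- If both low bits failed, adding the two inequalities would contradict the hypothesis. The number
`k` of conflicts pessimistically charged to the undecided neighbors counts against both colors,
whence `2 * k`. -/
theorem exists_low_bit {δ : ℕ} (O : Finset (Fin δ)) (W : ℕ → ℕ) {r : Fin δ → ℕ} {h k : ℕ}
    (hW : 2 * k + #{i ∈ O | r i ≠ 0} < W (2 * h) + W (2 * h + 1)) :
    ∃ l < 2, k + #{i ∈ O | r i = 2 * h + l + 1} < W (2 * h + l) := by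
  have h1 : #{i ∈ O | r i = 2 * h + 0 + 1} + #{i ∈ O | r i = 2 * h + 1 + 1} ≤
      #{i ∈ O | r i ≠ 0} := by
    rw [← card_union_of_disjoint]
    · refine card_le_card fun i hi => ?_
      simp only [mem_union, mem_filter] at hi ⊢
      rcases hi with hi | hi <;> exact ⟨hi.1, by omega⟩
    · exact disjoint_filter.2 fun i _ h1 h2 => by omega
  by_contra! hcon
  have ha := hcon 0 (by norm_num)
  have hb := hcon 1 (by norm_num)
  simp only [add_zero] at ha h1
  omega

/-- The choice of the high bit of a color in `{0, 1, 2, 3}` in the first sweep. -/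
noncomputable def highBit {δ : ℕ} (O : Finset (Fin δ)) (W : ℕ → ℕ) (r : Fin δ → ℕ) : ℕ :=
  -- Shifted by one, since `0` stands for a neighbor that has not chosen yet.
  (exists_high_bit O W (r := r)).choose + 1

/-- The choice of a color with high bit `h - 1` in the second sweep, where `hr` are the high bits
of the neighbors and `r` are the colors of the neighbors that have chosen already. -/
noncomputable def lowBit {δ : ℕ} (O : Finset (Fin δ)) (W : ℕ → ℕ) (h : ℕ) (hr r : Fin δ → ℕ) : ℕ :=
  -- Undecided neighbors with the same high bit are all counted as conflicts. The cap `4` and the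
  -- default `1` keep the value between `1` and `4` on arbitrary inputs.
  if hl : ∃ l < 2, #{i ∈ O | r i = 0 ∧ hr i = h} + #{i ∈ O | r i = 2 * (h - 1) + l + 1} <
    W (2 * (h - 1) + l) then min (2 * (h - 1) + hl.choose + 1) 4 else 1

/-- The two sweeps, in opposite orders, over `Q` colors. -/
noncomputable def twoSweep {δ : ℕ} (Q c : ℕ) (O : Finset (Fin δ)) (W : ℕ → ℕ) :
    Prog δ (ℕ × (Fin δ → ℕ)) :=
  (sweep (highBit O W) c Q).bind fun a =>
    (sweep (lowBit O W a.1 a.2) (Q - 1 - c) Q).bind fun a => .done (a.1 - 1, fun i => a.2 i - 1)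

/-- Let `A` and `B` count the active neighbors of smaller and larger color, and `k` those of smaller
color with the same high bit. The first sweep and `2 (A + B) < ∑ W` give `2k + B < W(2h) + W(2h +
1)`, which is what the second sweep needs. -/
theorem twoSweep_evals {Q : ℕ} {c : V → ℕ} (hc : ∀ v, c v < Q)
    {O : ∀ v, Finset (Fin (N.degree v))} (hO : ∀ v, ∀ i ∈ O v, c (N.nbr v i) ≠ c v)
    {W : V → ℕ → ℕ} (hW : ∀ v, 2 * #(O v) < ∑ y ∈ range 4, W v y) (hM : 5 ≤ M) :
    ∃ y : V → ℕ, Prog.Evals N M (Q + Q) (fun v => twoSweep Q (c v) (O v) (W v))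
        (fun v => (y v, fun i => y (N.nbr v i))) ∧
      ∀ v, y v < 4 ∧ mono N O y v < W v (y v) := by
  classical
  obtain ⟨h, hh, hspec⟩ := sweep_evals (N := N) (M := M) hc (F := fun v => highBit (O v) (W v))
    fun v r => by
      have := (exists_high_bit (O v) (W v) (r := r)).choose_spec.1
      unfold highBit
      omega
  have hc' : ∀ v, Q - 1 - c v < Q := fun v => by
    have := hc v
    omega
  obtain ⟨x, hx, hxspec⟩ := sweep_evals (N := N) (M := M) hc'
    (F := fun v => lowBit (O v) (W v) (h v) fun i => h (N.nbr v i)) fun v r => by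
      unfold lowBit
      split_ifs <;> omega
  have hh1 : ∀ v, 1 ≤ h v := fun v => by
    rw [hspec v]
    exact Nat.succ_pos _
  have hx1 : ∀ v, 1 ≤ x v := fun v => by
    rw [hxspec v]
    unfold lowBit
    split_ifs <;> omega
  have hval : ∀ v, ∃ l < 2, x v = 2 * (h v - 1) + l + 1 ∧ x v ≤ 4 ∧
      #{i ∈ O v | c (N.nbr v i) < c v ∧ h (N.nbr v i) = h v} +
        #{i ∈ O v | c v < c (N.nbr v i) ∧ x (N.nbr v i) = x v} < W v (x v - 1) := by
    intro v
    obtain ⟨h1, h2⟩ := (exists_high_bit (O v) (W v)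
      (r := fun i => if c (N.nbr v i) < c v then h (N.nbr v i) else 0)).choose_spec
    set b := (exists_high_bit (O v) (W v)
      (r := fun i => if c (N.nbr v i) < c v then h (N.nbr v i) else 0)).choose with hb
    have hv : h v = b + 1 := hspec v
    have hk : #{i ∈ O v | (if c (N.nbr v i) < c v then h (N.nbr v i) else 0) = b + 1} =
        #{i ∈ O v | c (N.nbr v i) < c v ∧ h (N.nbr v i) = h v} := by
      congr 1
      refine filter_congr fun i _ => ?_
      by_cases hlt : c (N.nbr v i) < c v <;> simp [hlt, hv]
    have hA : #{i ∈ O v | (if c (N.nbr v i) < c v then h (N.nbr v i) else 0) ≠ 0} =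
        #{i ∈ O v | c (N.nbr v i) < c v} := by
      congr 1
      refine filter_congr fun i _ => ?_
      have := hh1 (N.nbr v i)
      split_ifs <;> omega
    rw [hk, hA] at h2
    set r : Fin (N.degree v) → ℕ :=
      fun i => if Q - 1 - c (N.nbr v i) < Q - 1 - c v then x (N.nbr v i) else 0 with hr
    -- In the reverse order, the undecided active neighbors are exactly those of smaller color, as
    -- equal colors are excluded by `hO`.
    have hr0 : ∀ i ∈ O v, (r i = 0 ↔ c (N.nbr v i) < c v) := fun i hi => by
      have := hx1 (N.nbr v i)
      have := hO v i hi
      have := hc (N.nbr v i)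
      have := hc v
      simp only [hr]
      split_ifs <;> omega
    have hB : #{i ∈ O v | r i ≠ 0} = #{i ∈ O v | ¬ c (N.nbr v i) < c v} := by
      congr 1
      exact filter_congr fun i hi => not_congr (hr0 i hi)
    have hk' : #{i ∈ O v | r i = 0 ∧ h (N.nbr v i) = h v} =
        #{i ∈ O v | c (N.nbr v i) < c v ∧ h (N.nbr v i) = h v} := by
      congr 1
      exact filter_congr fun i hi => and_congr_left fun _ => hr0 i hi
    have hadd := card_filter_add_card_filter_not (s := O v) fun i => c (N.nbr v i) < c v
    have hl := exists_low_bit (O v) (W v) (r := r) (h := b)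
      (k := #{i ∈ O v | c (N.nbr v i) < c v ∧ h (N.nbr v i) = h v}) (by
        have := hW v
        omega)
    rw [← hk', show b = h v - 1 by omega] at hl
    have hxv : x v = min (2 * (h v - 1) + hl.choose + 1) 4 := by
      rw [hxspec v]
      exact dif_pos hl
    obtain ⟨hl1, hl2⟩ := hl.choose_spec
    set l := hl.choose
    have hxv' : x v = 2 * (h v - 1) + l + 1 := by omega
    refine ⟨l, hl1, hxv', by omega, ?_⟩
    rw [hk', ← hxv'] at hl2
    rw [hxv', Nat.add_sub_cancel, ← hxv']
    refine lt_of_le_of_lt (Nat.add_le_add_left (card_le_card fun i hi => ?_) _) hl2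
    obtain ⟨hiO, hlt, heq⟩ := mem_filter.1 hi
    have := hc (N.nbr v i)
    refine mem_filter.2 ⟨hiO, ?_⟩
    simp only [hr]
    rw [if_pos (by omega), heq]
  refine ⟨fun v => x v - 1, ?_, fun v => ⟨?_, ?_⟩⟩
  · exact hh.bind (hx.map fun v a => (a.1 - 1, fun i => a.2 i - 1))
  · obtain ⟨l, _, h1, h2, _⟩ := hval v
    dsimp only
    omega
  · obtain ⟨l, hl, h1, h2, h3⟩ := hval v
    refine lt_of_le_of_lt ((card_le_card fun i hi => ?_).trans (card_union_le _ _)) h3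
    obtain ⟨hiO, heq⟩ := mem_filter.1 hi
    dsimp only at heq
    obtain ⟨l', hl', h1', _, _⟩ := hval (N.nbr v i)
    have := hO v i hiO
    have := hh1 v
    have := hh1 (N.nbr v i)
    have := hx1 v
    have := hx1 (N.nbr v i)
    simp only [mem_union, mem_filter]
    rcases lt_or_gt_of_ne (hO v i hiO) with hlt | hlt
    · exact Or.inl ⟨hiO, hlt, by omega⟩
    · exact Or.inr ⟨hiO, hlt, by omega⟩

/-! ### Recursion over the base-4 digits of the color -/

open Classical in
/-- One level of the recursion: choose one of four colors with weights `W`, given `b`-bit colors. -/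
noncomputable def chooseQuarter (κ b : ℕ) {δ : ℕ} (c : ℕ) (O : Finset (Fin δ)) (W : ℕ → ℕ) :
    Prog δ (ℕ × (Fin δ → ℕ)) :=
  (linialStep (primeAbove (16 * κ * b)) b c O).bind fun c =>
    (linialStep (primeAbove (96 * κ)) 6 c O).bind fun c =>
      (Prog.exchange c).bind fun r =>
        twoSweep (primeAbove (96 * κ) ^ 2) c {i ∈ O | r i ≠ c} fun y => W y - #{i ∈ O | r i = c}

/-- Two reductions with defect fraction `1 / (16κ)` each leave `O(κ²)` colors, so that the sweeps
are short. The remaining monochromatic neighbors are dropped and paid for in advance by lowering all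
four weights, a total loss of at most `#O / (2κ)`; this is the slack in `hW`. -/
theorem chooseQuarter_evals {κ b : ℕ} (hκ : 1 ≤ κ) (hb : 1 ≤ b) (hbκ : b ≤ 1056 * κ) {c : V → ℕ}
    (hc : ∀ v, c v < 2 ^ b) {O : ∀ v, Finset (Fin (N.degree v))} (hO : ∀ v, mono N O c v = 0)
    {W : V → ℕ → ℕ}
    (hW : ∀ v, 2 * (1 + 1 / (4 * κ)) * (#(O v) : ℝ) < (∑ y ∈ range 4, W v y : ℕ))
    (hM : 2 ^ b ≤ M) (hM1 : primeAbove (16 * κ * b) ^ 2 ≤ M) (hM2 : primeAbove (96 * κ) ^ 2 ≤ M) :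
    ∃ y : V → ℕ, Prog.Evals N M (3 + 2 * primeAbove (96 * κ) ^ 2)
        (fun v => chooseQuarter κ b (c v) (O v) (W v)) (fun v => (y v, fun i => y (N.nbr v i))) ∧
      ∀ v, y v < 4 ∧ mono N O y v < W v (y v) := by
  classical
  set p₁ := primeAbove (16 * κ * b) with hp₁
  set p₂ := primeAbove (96 * κ) with hp₂
  have hprime₁ : p₁.Prime := primeAbove_prime _
  have hprime₂ : p₂.Prime := primeAbove_prime _
  have hlt₁ : 16 * κ * b < p₁ := lt_primeAbove _
  have hlt₂ : 96 * κ < p₂ := lt_primeAbove _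
  have hle₁ : p₁ ≤ 2 * (16 * κ * b) := primeAbove_le (by positivity)
  obtain ⟨c₁, he₁, hc₁⟩ := linialStep_evals hprime₁ b O
    (fun v => (hc v).trans_le (Nat.pow_le_pow_left hprime₁.two_le b))
    (fun v => (hc v).trans_le hM)
  -- After the first reduction the colors fit into six digits in base `p₂`; this explains the `96 =
  -- 6 * 16` in the choice of `p₂`.
  have hpow : p₁ ^ 2 ≤ p₂ ^ 6 := by
    calc p₁ ^ 2 ≤ (2 * (16 * κ * (1056 * κ))) ^ 2 := by
          refine Nat.pow_le_pow_left (hle₁.trans ?_) 2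
          gcongr
      _ = 33792 ^ 2 * κ ^ 4 := by ring
      _ ≤ 96 ^ 6 * κ ^ 6 := by
          refine Nat.mul_le_mul (by norm_num) (Nat.pow_le_pow_right hκ (by norm_num))
      _ = (96 * κ) ^ 6 := by ring
      _ ≤ p₂ ^ 6 := Nat.pow_le_pow_left hlt₂.le 6
  obtain ⟨c₂, he₂, hc₂⟩ := linialStep_evals hprime₂ 6 O
    (fun v => (hc₁ v).1.trans_le hpow) (fun v => (hc₁ v).1.trans_le hM1)
  have hmono : ∀ v, (mono N O c₂ v : ℝ) ≤ 1 / (8 * κ) * #(O v) := by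
    intro v
    have h1 := (hc₁ v).2
    have h2 := (hc₂ v).2
    have hκ0 : (0 : ℝ) < κ := by exact_mod_cast hκ
    have hb0 : (0 : ℝ) < b := by exact_mod_cast hb
    have e1 : (b : ℝ) / p₁ ≤ 1 / (16 * κ) := by
      rw [div_le_div_iff₀ (by exact_mod_cast hprime₁.pos) (by positivity)]
      have : ((16 * κ * b : ℕ) : ℝ) ≤ p₁ := by exact_mod_cast hlt₁.le
      push_cast at this
      linarith
    have e2 : ((6 : ℕ) : ℝ) / p₂ ≤ 1 / (16 * κ) := by
      rw [div_le_div_iff₀ (by exact_mod_cast hprime₂.pos) (by positivity)]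
      have : ((96 * κ : ℕ) : ℝ) ≤ p₂ := by exact_mod_cast hlt₂.le
      push_cast at this ⊢
      linarith
    have e3 : (1 : ℝ) / (8 * κ) = 1 / (16 * κ) + 1 / (16 * κ) := by
      field_simp
      norm_num
    have n0 := Nat.cast_nonneg (α := ℝ) #(O v)
    have e4 := mul_le_mul_of_nonneg_right e1 n0
    have e5 := mul_le_mul_of_nonneg_right e2 n0
    rw [hO v, Nat.cast_zero] at h1
    rw [e3, add_mul]
    linarith
  have hW' : ∀ v, 2 * #{i ∈ O v | c₂ (N.nbr v i) ≠ c₂ v} <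
      ∑ y ∈ range 4, (W v y - mono N O c₂ v) := by
    intro v
    have h1 : ∑ y ∈ range 4, W v y ≤ ∑ y ∈ range 4, (W v y - mono N O c₂ v) + 4 * mono N O c₂ v := by
      simp only [sum_range_succ, sum_range_zero]
      omega
    have h2 : #{i ∈ O v | c₂ (N.nbr v i) ≠ c₂ v} ≤ #(O v) := card_filter_le _ _
    have h3 : ((∑ y ∈ range 4, W v y : ℕ) : ℝ) ≤
        (∑ y ∈ range 4, (W v y - mono N O c₂ v) : ℕ) + 4 * mono N O c₂ v := by exact_mod_cast h1
    have h4 : (#{i ∈ O v | c₂ (N.nbr v i) ≠ c₂ v} : ℝ) ≤ #(O v) := by exact_mod_cast h2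
    have h5 := hmono v
    have h6 := hW v
    have h7 : 2 * (1 + 1 / (4 * (κ : ℝ))) * #(O v) = 2 * #(O v) + 4 * (1 / (8 * κ) * #(O v)) := by
      field_simp
      ring
    have : (2 * #{i ∈ O v | c₂ (N.nbr v i) ≠ c₂ v} : ℝ) <
        (∑ y ∈ range 4, (W v y - mono N O c₂ v) : ℕ) := by linarith
    exact_mod_cast this
  obtain ⟨y, hy, hyspec⟩ := twoSweep_evals (N := N) (M := M) (fun v => (hc₂ v).1)
    (O := fun v => {i ∈ O v | c₂ (N.nbr v i) ≠ c₂ v}) (fun v i hi => (mem_filter.1 hi).2)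
    (W := fun v y => W v y - mono N O c₂ v) hW' (by
      refine le_trans ?_ hM2
      calc 5 ≤ 96 ^ 2 := by norm_num
        _ ≤ p₂ ^ 2 := Nat.pow_le_pow_left (by omega) 2)
  refine ⟨y, ?_, fun v => ⟨(hyspec v).1, ?_⟩⟩
  · rw [show 3 + 2 * p₂ ^ 2 = 1 + (1 + (1 + (p₂ ^ 2 + p₂ ^ 2))) by ring]
    exact he₁.bind (he₂.bind ((Prog.Evals.exchange fun v => (hc₂ v).1.trans_le hM2).bind hy))
  · have h1 := (hyspec v).2
    have h2 : mono N O y v ≤ mono N (fun v => {i ∈ O v | c₂ (N.nbr v i) ≠ c₂ v}) y v +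
        mono N O c₂ v := by
      unfold mono
      refine (card_le_card fun i hi => ?_).trans (card_union_le _ _)
      simp only [mem_union, mem_filter] at hi ⊢
      tauto
    omega

theorem sum_range_four_mul (n : ℕ) (w : ℕ → ℕ) :
    ∑ x ∈ range (4 * n), w x = ∑ y ∈ range 4, ∑ z ∈ range n, w (y + 4 * z) := by
  induction n with
  | zero => simp
  | succ n ih =>
    rw [mul_add, mul_one]
    simp only [sum_range_succ, sum_range_zero, zero_add] at ih ⊢
    rw [ih]
    ring_nf

/-- The factor by which the total weight has to exceed the outdegree, per level. -/
noncomputable def levelFactor (κ : ℕ) : ℝ := 2 * (1 + 1 / (4 * κ))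

open Classical in
/-- Choose one of `4 ^ k` colors with weights `w`, given `b`-bit colors. -/
noncomputable def chooseColor (κ b : ℕ) {δ : ℕ} (c : ℕ) :
    ℕ → Finset (Fin δ) → (ℕ → ℕ) → Prog δ ℕ
  | 0, _, _ => .done 0
  | k + 1, O, w =>
    (chooseQuarter κ b c O
      fun y => ⌈((∑ z ∈ range (4 ^ k), w (y + 4 * z) : ℕ) : ℝ) / levelFactor κ ^ k⌉₊).bind fun a =>
        (chooseColor κ b c k {i ∈ O | a.2 i = a.1} fun z => w (a.1 + 4 * z)).bind fun z =>
          .done (a.1 + 4 * z)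

/-- The invariant is that the weight exceeds `levelFactor κ ^ k` times the number of active
neighbors. Scaling the class sums by `levelFactor κ ^ k` makes the guarantee of
`chooseQuarter_evals` the invariant of the chosen class. -/
theorem chooseColor_evals {κ b : ℕ} (hκ : 1 ≤ κ) (hb : 1 ≤ b) (hbκ : b ≤ 1056 * κ) {c : V → ℕ}
    (hc : ∀ v, c v < 2 ^ b)
    (hM : 2 ^ b ≤ M) (hM1 : primeAbove (16 * κ * b) ^ 2 ≤ M) (hM2 : primeAbove (96 * κ) ^ 2 ≤ M)
    (k : ℕ) {O : ∀ v, Finset (Fin (N.degree v))} (hO : ∀ v, mono N O c v = 0) {w : V → ℕ → ℕ}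
    (hw : ∀ v, levelFactor κ ^ k * (#(O v) : ℝ) < (∑ x ∈ range (4 ^ k), w v x : ℕ)) :
    ∃ x : V → ℕ, Prog.Evals N M (k * (3 + 2 * primeAbove (96 * κ) ^ 2))
        (fun v => chooseColor κ b (c v) k (O v) (w v)) x ∧
      ∀ v, x v < 4 ^ k ∧ mono N O x v < w v (x v) := by
  classical
  have hγ : 0 < levelFactor κ := by
    unfold levelFactor
    positivity
  induction k generalizing O w with
  | zero =>
    refine ⟨fun _ => 0, ?_, fun v => ⟨by simp, ?_⟩⟩
    · rw [zero_mul]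
      exact fun v => rfl
    · have h := hw v
      simp only [pow_zero, one_mul, sum_range_one, Nat.cast_lt] at h
      exact (card_filter_le _ _).trans_lt h
  | succ k ih =>
    have hγk : 0 < levelFactor κ ^ k := by positivity
    obtain ⟨y, hy, hyspec⟩ := chooseQuarter_evals (N := N) (M := M) hκ hb hbκ hc hO
      (W := fun v y =>
        ⌈((∑ z ∈ range (4 ^ k), w v (y + 4 * z) : ℕ) : ℝ) / levelFactor κ ^ k⌉₊) (fun v => by
          calc 2 * (1 + 1 / (4 * κ)) * (#(O v) : ℝ)
              < (∑ x ∈ range (4 ^ (k + 1)), w v x : ℕ) / levelFactor κ ^ k := by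
                rw [lt_div_iff₀ hγk]
                refine lt_of_eq_of_lt ?_ (hw v)
                change levelFactor κ * _ * _ = _
                ring
            _ = ∑ y ∈ range 4,
                ((∑ z ∈ range (4 ^ k), w v (y + 4 * z) : ℕ) : ℝ) / levelFactor κ ^ k := by
                rw [← sum_div, ← Nat.cast_sum, ← sum_range_four_mul, pow_succ, mul_comm (4 ^ k)]
            _ ≤ _ := by
                rw [Nat.cast_sum]
                exact sum_le_sum fun y _ => Nat.le_ceil _) hM hM1 hM2
    obtain ⟨z, hz, hzspec⟩ := ih (O := fun v => {i ∈ O v | y (N.nbr v i) = y v})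
      (w := fun v z => w v (y v + 4 * z))
      -- The same coloring `c` serves all levels: it stays proper on fewer active ports.
      (fun v => Nat.eq_zero_of_le_zero <| (hO v) ▸ card_le_card
        (filter_subset_filter _ (filter_subset _ _)))
      (fun v => by
        -- Rounding up loses nothing: an integer below the ceiling is below the number itself.
        have h := Nat.lt_ceil.1 (hyspec v).2
        rw [lt_div_iff₀ hγk, mul_comm] at h
        exact h)
    refine ⟨fun v => y v + 4 * z v, ?_, fun v => ⟨?_, ?_⟩⟩
    · rw [add_mul, one_mul, add_comm]
      exact hy.bind (hz.map fun v z => y v + 4 * z)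
    · have h1 := (hyspec v).1
      have h2 := (hzspec v).1
      rw [pow_succ]
      dsimp only
      omega
    · refine lt_of_le_of_lt (card_le_card fun i hi => ?_) (hzspec v).2
      obtain ⟨hiO, heq⟩ := mem_filter.1 hi
      have h1 := (hyspec v).1
      have h2 := (hyspec (N.nbr v i)).1
      dsimp only at heq
      simp only [mem_filter]
      exact ⟨⟨hiO, by omega⟩, by omega⟩

end Sweep

/-! ### Solving the instance and estimating the constants -/

section Solve

open Finset

variable {V : Type*} {N : Network V} {C q : ℕ}

theorem Network.nbr_injective (N : Network V) (v : V) : Function.Injective (N.nbr v) := fun _ _ h =>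
  (N.port v).injective (Subtype.ext h)

open Classical in
/-- The ports that lead to outneighbors. -/
noncomputable def LocalInput.outFinset {δ : ℕ} (inp : LocalInput q δ) : Finset (Fin δ) :=
  {i | i ∈ inp.outPorts}

/-- The weight of the color `x`: its defect plus one if it is in the list, and zero otherwise. -/
noncomputable def LocalInput.weight {δ : ℕ} (inp : LocalInput q δ) (x : ℕ) : ℕ :=
  if h : x ∈ inp.list then inp.defect ⟨x, h⟩ + 1 else 0

theorem mem_outFinset_localInput (φ : N.graph.Coloring (Fin q)) (I : OLDCInstance N.graph C) {v : V}
    {i : Fin (N.degree v)} :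
    i ∈ (localInput N φ I v).outFinset ↔ I.orient.out v (N.nbr v i) := by
  classical
  exact ⟨fun h => (mem_filter.1 h).2, fun h => mem_filter.2 ⟨Finset.mem_univ _, h⟩⟩

theorem ncard_out_eq_card (φ : N.graph.Coloring (Fin q)) (I : OLDCInstance N.graph C) (v : V)
    (P : V → Prop) [DecidablePred P] :
    {u | I.orient.out v u ∧ P u}.ncard = #{i ∈ (localInput N φ I v).outFinset | P (N.nbr v i)} := by
  classical
  rw [← Set.ncard_coe_finset, ← Set.ncard_image_of_injective _ (N.nbr_injective v)]
  congr 1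
  ext u
  constructor
  · rintro ⟨hu, hP⟩
    obtain ⟨i, hi⟩ := (N.port v).surjective ⟨u, I.orient.adj_of_out v u hu⟩
    have hi' : N.nbr v i = u := congrArg Subtype.val hi
    subst hi'
    exact ⟨i, mem_filter.2 ⟨(mem_outFinset_localInput φ I).2 hu, hP⟩, rfl⟩
  · rintro ⟨i, hi, rfl⟩
    exact (mem_filter.1 hi).imp_left (mem_outFinset_localInput φ I).1

theorem card_outFinset_le_beta (φ : N.graph.Coloring (Fin q)) (I : OLDCInstance N.graph C) (v : V) :
    #(localInput N φ I v).outFinset ≤ I.beta v := by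
  have h := ncard_out_eq_card φ I v fun _ => True
  simp only [and_true, filter_true] at h
  rw [← h]
  exact le_max_right _ _

theorem sum_weight (φ : N.graph.Coloring (Fin q)) (I : OLDCInstance N.graph C) (v : V) :
    ∑ z ∈ range C, (localInput N φ I v).weight (z + 1) = ∑ x : I.list v, (I.defect v x + 1) := by
  calc _ = ∑ x ∈ Icc 1 C, (localInput N φ I v).weight x := by
        rw [range_eq_Ico, sum_Ico_add' (fun x => (localInput N φ I v).weight x) 0 C 1]
        rfl
    _ = ∑ x ∈ I.list v, (localInput N φ I v).weight x := by
        refine (sum_subset (I.list_subset v) fun x _ hx => ?_).symm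
        exact dif_neg hx
    _ = ∑ x : I.list v, (localInput N φ I v).weight x := (sum_coe_sort _ _).symm
    _ = _ := sum_congr rfl fun x _ => dif_pos x.2

theorem isSolution_of_card_lt_weight (φ : N.graph.Coloring (Fin q)) (I : OLDCInstance N.graph C)
    {x : V → ℕ}
    (hx : ∀ v, mono N (fun v => (localInput N φ I v).outFinset) x v <
      (localInput N φ I v).weight (x v)) : I.IsSolution x := by
  intro v
  have h := hx v
  unfold LocalInput.weight at h
  split_ifs at h with hmem
  · refine ⟨hmem, ?_⟩
    rw [ncard_out_eq_card φ I v fun u => x u = x v]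
    exact Nat.lt_succ_iff.1 h
  · omega

open Classical in
/-- The program of a node if there are at least two colors. -/
noncomputable def solve (C : ℕ) (t : ℕ) {δ : ℕ} (inp : LocalInput q δ) : Prog δ ℕ :=
  (reduceColors (2 * Nat.clog 4 C + 5) inp.outFinset t (Nat.clog 2 q + 1) inp.color).bind fun c =>
    (Prog.exchange c).bind fun r =>
      (chooseColor (Nat.clog 4 C) (finalBits (2 * Nat.clog 4 C + 5)) c (Nat.clog 4 C)
        {i ∈ inp.outFinset | r i ≠ c}
        fun z => inp.weight (z + 1) - #{i ∈ inp.outFinset | r i = c}).bind fun z => .done (z + 1)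

theorem levelFactor_pow_le {κ : ℕ} (hκ : 1 ≤ κ) : levelFactor κ ^ κ ≤ 4 / 3 * 2 ^ κ := by
  have hκ0 : (1 : ℝ) ≤ κ := by exact_mod_cast hκ
  set a : ℝ := 1 / (4 * κ) with ha
  have ha0 : 0 < a := by positivity
  have haκ : κ * a = 1 / 4 := by
    rw [ha]
    field_simp
  have ha1 : a ≤ 1 / 4 := by nlinarith
  -- Bernoulli gives `(1 - a) ^ κ ≥ 3 / 4`, and `(1 + a) ^ κ (1 - a) ^ κ ≤ 1` turns this into an
  -- upper bound for `(1 + a) ^ κ`.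
  have h1 := one_add_mul_le_pow (a := -a) (by linarith) κ
  have h2 : (1 + a) ^ κ * (1 + -a) ^ κ ≤ 1 := by
    rw [← mul_pow]
    refine pow_le_one₀ ?_ ?_ <;> nlinarith
  have h3 : 0 < (1 + a) ^ κ := by positivity
  have h4 : (1 + a) ^ κ ≤ 4 / 3 := by nlinarith
  unfold levelFactor
  rw [mul_pow, mul_comm]
  gcongr

theorem two_pow_clog_four_le (hC : 2 ≤ C) : (2 : ℝ) ^ Nat.clog 4 C ≤ 2 * √(C : ℝ) := by
  have h1 := Nat.pow_pred_clog_lt_self (b := 4) (by norm_num) (show 1 < C by omega)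
  have h2 : 0 < Nat.clog 4 C := Nat.clog_pos (by norm_num) hC
  obtain ⟨k, hk⟩ : ∃ k, Nat.clog 4 C = k + 1 := ⟨_, (Nat.succ_pred_eq_of_pos h2).symm⟩
  rw [hk, Nat.pred_succ] at h1
  have h3 : (2 : ℝ) ^ k ≤ √(C : ℝ) := by
    refine Real.le_sqrt_of_sq_le ?_
    rw [← pow_mul, mul_comm, pow_mul]
    norm_num
    exact_mod_cast h1.le
  rw [hk, pow_succ]
  linarith

theorem clog_four_le (hC : 2 ≤ C) : (Nat.clog 4 C : ℝ) ≤ 2 * Real.logb 2 C := by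
  have hC0 : (0 : ℝ) < C := by positivity
  have hlog : 1 ≤ Real.logb 2 C := by
    rw [Real.le_logb_iff_rpow_le (by norm_num) hC0, Real.rpow_one]
    exact_mod_cast hC
  have h1 := Nat.pow_pred_clog_lt_self (b := 4) (by norm_num) (show 1 < C by omega)
  have h2 : 0 < Nat.clog 4 C := Nat.clog_pos (by norm_num) hC
  obtain ⟨k, hk⟩ : ∃ k, Nat.clog 4 C = k + 1 := ⟨_, (Nat.succ_pred_eq_of_pos h2).symm⟩
  rw [hk, Nat.pred_succ] at h1
  have h3 : (k : ℝ) ≤ Real.logb 2 C := by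
    rw [Real.le_logb_iff_rpow_le (by norm_num) hC0, Real.rpow_natCast]
    exact_mod_cast (Nat.pow_le_pow_left (by norm_num) k).trans h1.le
  rw [hk]
  push_cast
  linarith

theorem clog_two_le (q : ℕ) : (Nat.clog 2 q : ℝ) ≤ Real.logb 2 q + 1 := by
  rcases le_or_gt q 1 with h | h
  · rw [Nat.clog_of_right_le_one h]
    interval_cases q <;> simp
  · have h1 := Nat.pow_pred_clog_lt_self (b := 2) (by norm_num) h
    have h2 : 0 < Nat.clog 2 q := Nat.clog_pos (by norm_num) h
    obtain ⟨k, hk⟩ : ∃ k, Nat.clog 2 q = k + 1 := ⟨_, (Nat.succ_pred_eq_of_pos h2).symm⟩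
    rw [hk, Nat.pred_succ] at h1
    have h3 : (k : ℝ) ≤ Real.logb 2 q := by
      rw [Real.le_logb_iff_rpow_le (by norm_num) (by positivity), Real.rpow_natCast]
      exact_mod_cast h1.le
    rw [hk]
    push_cast
    linarith

theorem logb_two_natCast_nonneg (q : ℕ) : 0 ≤ Real.logb 2 q := by
  rcases Nat.eq_zero_or_pos q with rfl | h
  · simp
  · exact Real.logb_nonneg (by norm_num) (by exact_mod_cast h)

/-- Removing the ports that are monochromatic after the reduction makes the coloring proper on the
rest, and the lowered weights reserve room for the removed neighbors. -/
theorem solve_evals (hC : 2 ≤ C) {t : ℕ}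
    (ht : (nextBits (2 * Nat.clog 4 C + 5))^[t] (Nat.clog 2 q + 1) ≤
      finalBits (2 * Nat.clog 4 C + 5))
    (ht' : ∀ s < t, finalBits (2 * Nat.clog 4 C + 5) <
      (nextBits (2 * Nat.clog 4 C + 5))^[s] (Nat.clog 2 q + 1))
    (φ : N.graph.Coloring (Fin q)) (I : OLDCInstance N.graph C)
    (hI : ∀ v, 3 * √(C : ℝ) * (I.beta v : ℝ) ≤ ((∑ x : I.list v, (I.defect v x + 1) : ℕ) : ℝ)) :
    ∃ x : V → ℕ,
      Prog.Evals N (2 ^ (Nat.clog 2 q + 1 + finalBits (2 * Nat.clog 4 C + 5)))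
        (t + (1 + Nat.clog 4 C * (3 + 2 * primeAbove (96 * Nat.clog 4 C) ^ 2)))
        (fun v => solve C t (localInput N φ I v)) x ∧ I.IsSolution x := by
  classical
  set κ := Nat.clog 4 C with hκ
  set B := finalBits (2 * κ + 5) with hB
  set M := 2 ^ (Nat.clog 2 q + 1 + B) with hM
  have hB' : B = 16 * κ + 1040 := by
    rw [hB]
    unfold finalBits
    ring
  have hκ1 : 1 ≤ κ := Nat.clog_pos (by norm_num) hC
  have hBM : 2 ^ B ≤ M := Nat.pow_le_pow_right (by norm_num) (Nat.le_add_left _ _)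
  have hqM : 2 ^ (Nat.clog 2 q + 1) ≤ M := Nat.pow_le_pow_right (by norm_num) (Nat.le_add_right _ _)
  have hB0 : 0 < B := by omega
  clear_value M B
  set O : ∀ v, Finset (Fin (N.degree v)) := fun v => (localInput N φ I v).outFinset with hO
  obtain ⟨c, hc, hcspec⟩ := reduceColors_evals (N := N) (M := M) (r := 2 * κ + 5) O (t := t)
    (b := Nat.clog 2 q + 1) (c := fun v => φ v) (by omega) (hB ▸ ht')
    (fun v => (φ v).2.trans_le ((Nat.le_pow_clog (by norm_num) q).trans
      (Nat.pow_le_pow_right (by norm_num) (by omega))))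
    hqM
  have hcB : ∀ v, c v < 2 ^ B := fun v =>
    (hcspec v).1.trans_le (Nat.pow_le_pow_right (by norm_num) ht)
  have hmono0 : ∀ v, mono N O (fun v => (φ v : ℕ)) v = 0 := fun v =>
    card_eq_zero.2 <| filter_eq_empty_iff.2 fun i _ h =>
      φ.valid ((N.port v i).2 : N.graph.Adj v (N.nbr v i)) (Fin.ext h).symm
  have hCκ : C ≤ 4 ^ κ := Nat.le_pow_clog (by norm_num) C
  have hκpow : κ ^ 4 ≤ 2 ^ (4 * κ) := by
    rw [mul_comm, pow_mul]
    exact Nat.pow_le_pow_left Nat.lt_two_pow_self.le 4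
  have hp1 : primeAbove (16 * κ * B) ^ 2 ≤ M := by
    refine le_trans ?_ hBM
    calc _ ≤ (2 * (16 * κ * (1056 * κ))) ^ 2 := by
          refine Nat.pow_le_pow_left ((primeAbove_le (by positivity)).trans ?_) 2
          gcongr
          omega
      _ = 33792 ^ 2 * κ ^ 4 := by ring
      _ ≤ 2 ^ 40 * 2 ^ (4 * κ) := Nat.mul_le_mul (by norm_num) hκpow
      _ = 2 ^ (40 + 4 * κ) := (pow_add _ _ _).symm
      _ ≤ 2 ^ B := Nat.pow_le_pow_right (by norm_num) (by omega)
  have hp2 : primeAbove (96 * κ) ^ 2 ≤ M := by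
    refine le_trans ?_ hBM
    calc _ ≤ (2 * (96 * κ)) ^ 2 := Nat.pow_le_pow_left (primeAbove_le (by positivity)) 2
      _ = 192 ^ 2 * κ ^ 2 := by ring
      _ ≤ 2 ^ 40 * κ ^ 4 :=
        Nat.mul_le_mul (by norm_num) (Nat.pow_le_pow_right hκ1 (by norm_num))
      _ ≤ 2 ^ 40 * 2 ^ (4 * κ) := Nat.mul_le_mul_left _ hκpow
      _ = 2 ^ (40 + 4 * κ) := (pow_add _ _ _).symm
      _ ≤ 2 ^ B := Nat.pow_le_pow_right (by norm_num) (by omega)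
  have hw : ∀ v, levelFactor κ ^ κ * (#{i ∈ O v | c (N.nbr v i) ≠ c v} : ℝ) <
      (∑ z ∈ range (4 ^ κ), ((localInput N φ I v).weight (z + 1) - mono N O c v) : ℕ) := by
    intro v
    have hC0 : (2 : ℝ) ≤ C := by exact_mod_cast hC
    have hβ1 : (1 : ℝ) ≤ I.beta v := by exact_mod_cast le_max_left 1 _
    have hOβ : (#(O v) : ℝ) ≤ I.beta v := by exact_mod_cast card_outFinset_le_beta φ I v
    have hsqrt : 1 ≤ √(C : ℝ) := Real.one_le_sqrt.2 (by linarith)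
    -- This is the purpose of `r = 2κ + 5`: `2 ^ r = 32 * 4 ^ κ ≥ 32 C`, so even a loss repeated for
    -- all `C` colors is at most `β_v / 32`.
    have hμ : (C : ℝ) * mono N O c v ≤ I.beta v / 32 := by
      have h1 := (hcspec v).2
      rw [hmono0, Nat.cast_zero, zero_add] at h1
      have h2 : (1 - 1 / ((Nat.clog 2 q + 1 : ℕ) : ℝ)) ≤ 1 := by
        have : (0 : ℝ) ≤ 1 / ((Nat.clog 2 q + 1 : ℕ) : ℝ) := by positivity
        linarith
      have h3 : (C : ℝ) * 32 ≤ 2 ^ (2 * κ + 5) := by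
        rw [pow_add, pow_mul]
        norm_num
        exact_mod_cast hCκ
      calc (C : ℝ) * mono N O c v ≤ C * (1 / (C * 32) * I.beta v) := by
            gcongr
            exact h1.trans (mul_le_mul (div_le_div₀ zero_le_one h2 (by positivity) h3) hOβ
              (Nat.cast_nonneg _) (by positivity))
        _ = I.beta v / 32 := by
            field_simp
    have hsum : ∑ x : I.list v, (I.defect v x + 1) ≤
        ∑ z ∈ range (4 ^ κ), ((localInput N φ I v).weight (z + 1) - mono N O c v) +
          C * mono N O c v := by
      calc _ = ∑ z ∈ range C, (localInput N φ I v).weight (z + 1) := (sum_weight φ I v).symm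
        _ ≤ ∑ z ∈ range C, (((localInput N φ I v).weight (z + 1) - mono N O c v) +
            mono N O c v) := sum_le_sum fun z _ => le_tsub_add
        _ = ∑ z ∈ range C, ((localInput N φ I v).weight (z + 1) - mono N O c v) +
            C * mono N O c v := by
          rw [sum_add_distrib, sum_const, card_range, smul_eq_mul]
        _ ≤ _ := Nat.add_le_add_right (sum_le_sum_of_subset (range_subset_range.2 hCκ)) _
    have hsum' : ((∑ x : I.list v, (I.defect v x + 1) : ℕ) : ℝ) ≤
        (∑ z ∈ range (4 ^ κ), ((localInput N φ I v).weight (z + 1) - mono N O c v) : ℕ) +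
          C * mono N O c v := by exact_mod_cast hsum
    have hγ : levelFactor κ ^ κ ≤ 8 / 3 * √(C : ℝ) := by
      have h1 := levelFactor_pow_le hκ1
      have h2 := two_pow_clog_four_le hC
      linarith
    have hleft : levelFactor κ ^ κ * (#{i ∈ O v | c (N.nbr v i) ≠ c v} : ℝ) ≤
        8 / 3 * √(C : ℝ) * I.beta v := by
      refine mul_le_mul hγ (le_trans ?_ hOβ) (Nat.cast_nonneg _) (by positivity)
      exact_mod_cast card_filter_le _ _
    -- The budget closes because `8 / 3 + 1 / 32 < 3`.
    have hβ : (I.beta v : ℝ) ≤ √(C : ℝ) * I.beta v := by nlinarith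
    have := hI v
    linarith
  obtain ⟨z, hz, hzspec⟩ := chooseColor_evals (N := N) (M := M) hκ1 (b := B) (by omega) (by omega)
    hcB hBM hp1 hp2 κ (O := fun v => {i ∈ O v | c (N.nbr v i) ≠ c v})
    (fun v => card_eq_zero.2 <| filter_eq_empty_iff.2 fun i hi => (mem_filter.1 hi).2) hw
  refine ⟨fun v => z v + 1, ?_, isSolution_of_card_lt_weight φ I fun v => ?_⟩
  · subst hB
    exact hc.bind ((Prog.Evals.exchange fun v => (hcB v).trans_le hBM).bind
      (hz.map fun v z => z + 1))
  · have h1 := (hzspec v).2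
    have h2 : mono N O (fun v => z v + 1) v ≤
        mono N (fun v => {i ∈ O v | c (N.nbr v i) ≠ c v}) z v + mono N O c v := by
      unfold mono
      refine (card_le_card fun i hi => ?_).trans (card_union_le _ _)
      simp only [mem_union, mem_filter, Nat.add_right_cancel_iff] at hi ⊢
      tauto
    change mono N O _ v < _
    omega

end Solve

theorem theorem2 :
    ∃ K : ℝ, ∀ q C : ℕ, 1 ≤ C → ∃ A : DistAlgorithm q,
      ∀ (V : Type*) [Finite V] (N : Network V) (φ : N.graph.Coloring (Fin q))
        (I : OLDCInstance N.graph C),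
        (∀ v, 3 * √(C : ℝ) * (I.beta v : ℝ) ≤ ((∑ x : I.list v, (I.defect v x + 1) : ℕ) : ℝ)) →
        (∃ (T : ℕ) (x : V → ℕ),
          (T : ℝ) ≤ K * (Real.logb 2 C ^ 3 + (logStar q : ℝ)) ∧
          (∀ v, A.output (A.run N (localInput N φ I) T v) = some (x v)) ∧
          I.IsSolution x) ∧
        (∀ (t : ℕ) (v : V) (i : Fin (N.degree v)),
          ((A.message (A.run N (localInput N φ I) t v) i).length : ℝ) ≤
            K * (Real.logb 2 q + Real.logb 2 C)) := by
  -- The round bound dictates the constant: `73732 * κ ^ 3` with `κ ≤ 2 log C` gives `8 * 73732 =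
  -- 589856`.
  refine ⟨600000, fun q C hC => ?_⟩
  have hq := logb_two_natCast_nonneg q
  -- For `C = 1` the term `log C` vanishes and cannot absorb constants; color `1` works at once,
  -- without communication, since its weight is at least `3 β_v`.
  rcases hC.eq_or_lt with rfl | hC2
  · refine ⟨Prog.algorithm fun _ => .done 1, fun V _ N φ I hI => ?_⟩
    have h : Prog.Evals N (2 ^ 0) 0 (fun v => (.done 1 : Prog (N.degree v) ℕ)) fun _ => 1 :=
      fun _ => rfl
    obtain ⟨h1, h2⟩ := Prog.algorithm_run_of_evals (fun _ => .done 1) (localInput N φ I) h (t := 0)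
      fun _ => rfl
    refine ⟨⟨0, fun _ => 1, by simp, h1, ?_⟩, fun t v i => ?_⟩
    · refine isSolution_of_card_lt_weight φ I fun v => ?_
      have h3 := hI v
      rw [← sum_weight φ I v] at h3
      simp only [Nat.cast_one, Real.sqrt_one, mul_one, Finset.sum_range_one, zero_add] at h3
      have h4 : 3 * I.beta v ≤ (localInput N φ I v).weight 1 := by exact_mod_cast h3
      have h5 : mono N (fun v => (localInput N φ I v).outFinset) (fun _ => 1) v ≤ I.beta v :=
        (Finset.card_filter_le _ _).trans (card_outFinset_le_beta φ I v)
      have h6 : 1 ≤ I.beta v := le_max_left _ _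
      omega
    · rw [Nat.eq_zero_of_le_zero (h2 t (Nat.zero_le _) v i)]
      simp only [Nat.cast_zero, Nat.cast_one, Real.logb_one, add_zero]
      positivity
  · obtain ⟨t, ht, hle, hlt⟩ := exists_reduction_time (2 * Nat.clog 4 C + 5) q
    refine ⟨Prog.algorithm (solve C t), fun V _ N φ I hI => ?_⟩
    obtain ⟨x, hx, hsol⟩ := solve_evals hC2 hle hlt φ I hI
    obtain ⟨h1, h2⟩ := Prog.algorithm_run_of_evals (solve C t) (localInput N φ I) hx (t := 0)
      fun _ => rfl
    rw [Nat.zero_add] at h1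
    have hκ := clog_four_le hC2
    have hκ1 : 1 ≤ Nat.clog 4 C := Nat.clog_pos (by norm_num) hC2
    have hlog1 : 1 ≤ Real.logb 2 C := by
      rw [Real.le_logb_iff_rpow_le (by norm_num) (by positivity), Real.rpow_one]
      exact_mod_cast hC2
    refine ⟨⟨_, x, ?_, h1, hsol⟩, fun t' v i => ?_⟩
    · have hT : t + (1 + Nat.clog 4 C * (3 + 2 * primeAbove (96 * Nat.clog 4 C) ^ 2)) ≤
          2 * logStar q + 73732 * Nat.clog 4 C ^ 3 := by
        set κ := Nat.clog 4 C
        have hp : primeAbove (96 * κ) ^ 2 ≤ (2 * (96 * κ)) ^ 2 :=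
          Nat.pow_le_pow_left (primeAbove_le (by positivity)) 2
        have h3 : 1 ≤ κ ^ 3 := Nat.one_le_pow _ _ hκ1
        have h4 : κ ≤ κ ^ 3 := Nat.le_self_pow (by norm_num) κ
        calc _ ≤ 2 * logStar q + (1 + κ * (3 + 2 * (2 * (96 * κ)) ^ 2)) := by gcongr
          _ = 2 * logStar q + (1 + 3 * κ + 73728 * κ ^ 3) := by ring
          _ ≤ _ := by omega
      have hκ3 : (Nat.clog 4 C : ℝ) ^ 3 ≤ (2 * Real.logb 2 C) ^ 3 := by gcongr
      have hT' : ((t + (1 + Nat.clog 4 C * (3 + 2 * primeAbove (96 * Nat.clog 4 C) ^ 2)) : ℕ) : ℝ) ≤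
          2 * logStar q + 73732 * (Nat.clog 4 C : ℝ) ^ 3 := by exact_mod_cast hT
      have hs : (0 : ℝ) ≤ logStar q := Nat.cast_nonneg _
      have hl3 : 0 ≤ Real.logb 2 C ^ 3 := by positivity
      rw [mul_pow] at hκ3
      linarith
    · have h3 : ((_ : ℕ) : ℝ) ≤ _ := Nat.cast_le.2 (h2 t' (Nat.zero_le _) v i)
      refine h3.trans ?_
      have h4 := clog_two_le q
      unfold finalBits
      push_cast
      linarith
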